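/- Let $\Bbbk$ be an algebraically closed field and let $\mathscr{C}$ be a locally-finite pivotal tensor $\Bbbk$-category: $\mathscr C$ is an abelian $\Bbbk$-linear monoidal category with $\Bbbk$-bilinear tensor product, all $\Bbbk$-modules $\operatorname{Hom}_{\mathscr C}(X,Y)$ have finite length, $\operatorname{End}_{\mathscr C}(\mathbf 1)=\Bbbk\operatorname{Id}$ with $\operatorname{Id}_{\mathbf 1}\neq 0$, and every object $V$ has a dual $V^*$ which is a left dual (via $\overleftarrow{\operatorname{coev}}_V:\mathbf 1\to V\otimes V^*$, $\overleftarrow{\operatorname{ev}}_V:V^*\otimes V\to\mathbf 1$) and a right dual (via $\overrightarrow{\operatorname{coev}}_V:\mathbf 1\to V^*\otimes V$, $\overrightarrow{\operatorname{ev}}_V:V\otimes V^*\to\mathbf 1$), such that the two dualities define the same transposes $f^*$ and the same canonical maps $W^*\otimes V^*\to(V\otimes W)^*$. A trace tuple $(P,\alpha,\beta,\eta,\epsilon)$ consists of objects $P,\alpha,\beta$ and nonzero morphisms $\eta:\alpha\to P$, $\epsilon:P\to\beta$ such that $\operatorname{End}(P)/J(\operatorname{End}(P))\cong\Bbbk$,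 the Jacobson radical $J(\operatorname{End}(P))$ is nilpotent, and $\operatorname{Hom}(\alpha,P)$ and $\operatorname{Hom}(P,\beta)$ are free $\Bbbk$-modules with bases $\{\eta\}$ and $\{\epsilon\}$. Let $I_\alpha^\beta$ be the class of objects $V$ for which $\eta\otimes\operatorname{Id}_V$ has a left inverse $P\otimes V\to\alpha\otimes V$ and $\epsilon\otimes\operatorname{Id}_V$ has a right inverse $\beta\otimes V\to P\otimes V$. Let $\operatorname{Proj}(\mathscr C)$ be the class of projective objects. An object $X$ is invertible if $\overleftarrow{\operatorname{ev}}_X$ and $\overleftarrow{\operatorname{coev}}_X$ are isomorphisms, and absolutely simple if it is simple and $\Bbbk\to\operatorname{End}(X)$, $c\mapsto c\operatorname{Id}_X$, is bijective. Theorem. Let $P$ be an indecomposable projective object of $\mathscr C$. Then there are absolutely simple objects $\alpha$ and $\beta$ and morphisms $\eta:\alpha\to P$ and $\epsilon:P\to\beta$ such that $\eta$ is the unique simple subobject (the socle) of $P$, $\epsilon$ is the unique simple quotient (the head) of $P$, $(P,\alpha,\beta,\eta,\epsilon)$ is a trace tuple, and $\operatorname{Proj}(\mathscr C)\subseteq I_\alpha^\beta$.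 These data are unique up to isomorphism: if $(P,\alpha',\beta',\eta',\epsilon')$ is a trace tuple with $\alpha'$ and $\beta'$ simple, there are isomorphisms $a:\alpha\to\alpha'$ and $b:\beta\to\beta'$ with $\eta'a=\eta$ and $b\epsilon=\epsilon'$. Moreover, if $\alpha$ or $\beta$ is invertible, then $\operatorname{Proj}(\mathscr C)=I_\alpha^\beta$. -/

import Mathlib

open CategoryTheory CategoryTheory.Limits CategoryTheory.MonoidalCategory

universe v u w

namespace MTrace

section Pivotal

variable (C : Type u) [Category.{v} C] [MonoidalCategory C]

/-- A left duality and a right duality on a monoidal category with the same dual objects `V*`.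
The left duality consists of `coev : 𝟙 ⟶ V ⊗ V*` and `ev : V* ⊗ V ⟶ 𝟙`, the right duality of
`coev : 𝟙 ⟶ V* ⊗ V` and `ev : V ⊗ V* ⟶ 𝟙`, each subject to the two zigzag identities. -/
class TwoSidedDuality where
  /-- The dual object `V*`. -/
  dual : C → C
  /-- The left duality. -/
  leftPairing : ∀ V : C, ExactPairing V (dual V)
  /-- The right duality. -/
  rightPairing : ∀ V : C, ExactPairing (dual V) V

variable {C}
variable [TwoSidedDuality C]

/-- The dual object `V*`. -/
abbrev dual (V : C) : C := TwoSidedDuality.dual V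

/-- Left coevaluation `𝟙 ⟶ V ⊗ V*`. -/
def coevL (V : C) : 𝟙_ C ⟶ V ⊗ dual V :=
  (TwoSidedDuality.leftPairing V).coevaluation'

/-- Left evaluation `V* ⊗ V ⟶ 𝟙`. -/
def evL (V : C) : dual V ⊗ V ⟶ 𝟙_ C :=
  (TwoSidedDuality.leftPairing V).evaluation'

/-- Right coevaluation `𝟙 ⟶ V* ⊗ V`. -/
def coevR (V : C) : 𝟙_ C ⟶ dual V ⊗ V :=
  (TwoSidedDuality.rightPairing V).coevaluation'

/-- Right evaluation `V ⊗ V* ⟶ 𝟙`. -/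
def evR (V : C) : V ⊗ dual V ⟶ 𝟙_ C :=
  (TwoSidedDuality.rightPairing V).evaluation'

/-- The transpose `W* ⟶ V*` of `f : V ⟶ W` with respect to the left duality. -/
def transposeL {V W : C} (f : V ⟶ W) : dual W ⟶ dual V :=
  𝟙 (dual W) ⊗≫ dual W ◁ coevL V ⊗≫ dual W ◁ f ▷ dual V ⊗≫ evL W ▷ dual V ⊗≫ 𝟙 (dual V)

/-- The transpose `W* ⟶ V*` of `f : V ⟶ W` with respect to the right duality. -/
def transposeR {V W : C} (f : V ⟶ W) : dual W ⟶ dual V :=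
  𝟙 (dual W) ⊗≫ coevR V ▷ dual W ⊗≫ dual V ◁ f ▷ dual W ⊗≫ dual V ◁ evR W ⊗≫ 𝟙 (dual V)

/-- The canonical map `W* ⊗ V* ⟶ (V ⊗ W)*` determined by the left duality. -/
def gammaL (V W : C) : dual W ⊗ dual V ⟶ dual (V ⊗ W) :=
  𝟙 (dual W ⊗ dual V) ⊗≫ (dual W ⊗ dual V) ◁ coevL (V ⊗ W) ⊗≫
    dual W ◁ evL V ▷ (W ⊗ dual (V ⊗ W)) ⊗≫ evL W ▷ dual (V ⊗ W) ⊗≫ 𝟙 (dual (V ⊗ W))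

/-- The canonical map `W* ⊗ V* ⟶ (V ⊗ W)*` determined by the right duality. -/
def gammaR (V W : C) : dual W ⊗ dual V ⟶ dual (V ⊗ W) :=
  𝟙 (dual W ⊗ dual V) ⊗≫ coevR (V ⊗ W) ▷ (dual W ⊗ dual V) ⊗≫
    (dual (V ⊗ W) ⊗ V) ◁ evR W ▷ dual V ⊗≫ dual (V ⊗ W) ◁ evR V ⊗≫ 𝟙 (dual (V ⊗ W))

variable (C) in
/-- A pivotal structure on a monoidal category: a left and a right duality with the same dual
objects, the same transposes, and the same canonical maps `W* ⊗ V* ⟶ (V ⊗ W)*`. -/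
class Pivotal extends TwoSidedDuality C where
  transpose_eq : ∀ {V W : C} (f : V ⟶ W), transposeL f = transposeR f
  gamma_eq : ∀ V W : C, gammaL V W = gammaR V W

/-- `X` is invertible if the left evaluation `X* ⊗ X ⟶ 𝟙` and the left coevaluation
`𝟙 ⟶ X ⊗ X*` are isomorphisms. -/
def IsInvertible (X : C) : Prop := IsIso (evL X) ∧ IsIso (coevL X)

end Pivotal

section Linear

variable (k : Type w) [CommRing k] {C : Type u} [Category.{v} C] [Preadditive C] [Linear k C]

variable (C) in
/-- All modules of morphisms have finite length over `k`. -/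
def LocallyFinite : Prop := ∀ X Y : C, IsFiniteLength k (X ⟶ Y)

/-- The map `k → End V`, `c ↦ c • 𝟙`, is bijective. -/
def AbsolutelyIrreducible (V : C) : Prop := Function.Bijective fun c : k => c • 𝟙 V

/-- The quotient of `End V` by its Jacobson radical is isomorphic to `k`. -/
def AbsolutelyIndecomposable (V : C) : Prop :=
  Nonempty ((End V ⧸ Ring.jacobson (End V)) ≃ₐ[k] k)

/-- The Jacobson radical of `End V` is nilpotent. -/
def EndNilpotent (V : C) : Prop := IsNilpotent (Ring.jacobson (End V))

/-- `(P, α, β, η, ε)` is a trace tuple. -/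
structure IsTraceTuple (P α β : C) (η : α ⟶ P) (ε : P ⟶ β) : Prop where
  eta_ne_zero : η ≠ 0
  epsilon_ne_zero : ε ≠ 0
  absolutelyIndecomposable : AbsolutelyIndecomposable k P
  endNilpotent : EndNilpotent P
  /-- `Hom(α, P)` is free over `k` with basis `η`. -/
  eta_basis : Function.Bijective fun c : k => c • η
  /-- `Hom(P, β)` is free over `k` with basis `ε`. -/
  epsilon_basis : Function.Bijective fun c : k => c • ε

end Linear

section Ideals

variable {C : Type u} [Category.{v} C] [MonoidalCategory C]

/-- The objects `V` for which `η ⊗ V : α ⊗ V ⟶ P ⊗ V` has a left inverse. -/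
def lowerIdeal {P α : C} (η : α ⟶ P) : ObjectProperty C :=
  fun V => ∃ s : P ⊗ V ⟶ α ⊗ V, η ▷ V ≫ s = 𝟙 (α ⊗ V)

/-- The objects `V` for which `ε ⊗ V : P ⊗ V ⟶ β ⊗ V` has a right inverse. -/
def upperIdeal {P β : C} (ε : P ⟶ β) : ObjectProperty C :=
  fun V => ∃ t : β ⊗ V ⟶ P ⊗ V, t ≫ ε ▷ V = 𝟙 (β ⊗ V)

/-- The class of objects `I_α^β = I_α ∩ I^β` attached to `η : α ⟶ P` and `ε : P ⟶ β`. -/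
def traceIdeal {P α β : C} (η : α ⟶ P) (ε : P ⟶ β) : ObjectProperty C :=
  lowerIdeal η ⊓ upperIdeal ε

end Ideals

section SocleHead

variable {C : Type u} [Category.{v} C] [HasZeroMorphisms C]

/-- `η : α ⟶ P` is the unique simple subobject of `P`. -/
structure IsUniqueSimpleSubobject {P α : C} (η : α ⟶ P) : Prop where
  simple : Simple α
  mono : Mono η
  unique : ∀ (S : C) (i : S ⟶ P), Simple S → Mono i → ∃ e : S ≅ α, e.hom ≫ η = i

/-- `ε : P ⟶ β` is the unique simple quotient of `P`. -/
structure IsUniqueSimpleQuotient {P β : C} (ε : P ⟶ β) : Prop where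
  simple : Simple β
  epi : Epi ε
  unique : ∀ (S : C) (q : P ⟶ S), Simple S → Epi q → ∃ e : β ≅ S, ε ≫ e.hom = q

end SocleHead

end MTrace

/-! Indecomposability leaves `End P` without nontrivial idempotents; being finite-dimensional, it is
local with nilpotent radical, and its residue field is `k` since `k` is algebraically closed.
Duality makes tensoring exact and preserve projectives and injectives, and it makes projectives
injective (`injective_of_projective`). A projective (injective) object with local endomorphism ring
has at most one simple quotient (subobject).

Objects are not assumed to have finite length, so existence of a head and socle needs an argument.
The unit is simple (`simple_unit`), whence every nonzero quotient of `P` maps nontrivially to one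
fixed object; minimizing the dimension of that Hom space yields a simple quotient. Subobjects are
treated dually.

For projective `V`, injectivity of `α ⊗ V` and projectivity of `β ⊗ V` split the maps defining the
ideal. Conversely, such a splitting makes `α ⊗ V` or `β ⊗ V` a summand of the projective `P ⊗ V`,
and an invertible factor cancels. -/

namespace MTrace

/-! ### Finite-dimensional local algebras -/

section LocalAlgebra

variable (k : Type*) {A : Type*} [Field k] [Ring A]

/-- In a finite-dimensional algebra without nontrivial idempotents, every element is nilpotent or
invertible. -/
theorem isNilpotent_or_isUnit [Algebra k A] [FiniteDimensional k A]
    (h : ∀ e : A, e * e = e → e = 0 ∨ e = 1) (x : A) :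
    IsNilpotent x ∨ IsUnit x := by
  have hm : minpoly k x ≠ 0 := minpoly.ne_zero (IsIntegral.of_finite k x)
  obtain ⟨q, hq, hdvd⟩ := Polynomial.exists_eq_pow_rootMultiplicity_mul_and_not_dvd _ hm 0
  rw [Polynomial.C_0, sub_zero] at hq hdvd
  set n := (minpoly k x).rootMultiplicity 0
  -- The exponent `n + 1` keeps a factor `x` in the idempotent below even when `n = 0`; this factor
  -- gives the inverse of `x` when the idempotent is `1`.
  have hcop : IsCoprime (Polynomial.X ^ (n + 1)) q :=
    IsCoprime.pow_left ((Polynomial.irreducible_X.coprime_iff_not_dvd).2 hdvd)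
  obtain ⟨a, b, hab⟩ := hcop
  have hmx : Polynomial.aeval x (Polynomial.X ^ n * q) = 0 := by rw [← hq, minpoly.aeval]
  have hx : Polynomial.aeval x (Polynomial.X ^ (n + 1) * q) = 0 := by
    rw [pow_succ', mul_assoc, map_mul, hmx, mul_zero]
  have hidem : Polynomial.aeval x (a * Polynomial.X ^ (n + 1)) *
      Polynomial.aeval x (a * Polynomial.X ^ (n + 1)) =
      Polynomial.aeval x (a * Polynomial.X ^ (n + 1)) := by
    have : a * Polynomial.X ^ (n + 1) = a * Polynomial.X ^ (n + 1) * (a * Polynomial.X ^ (n + 1)) +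
        a * b * (Polynomial.X ^ (n + 1) * q) := by
      linear_combination (-(a * Polynomial.X ^ (n + 1))) * hab
    conv_rhs => rw [this, map_add, map_mul _ (a * b), hx, mul_zero, add_zero, map_mul]
  rcases h _ hidem with h0 | h1
  · left
    refine ⟨n + 1, ?_⟩
    have : Polynomial.X ^ (n + 1) = Polynomial.X ^ (n + 1) * (a * Polynomial.X ^ (n + 1)) +
        b * (Polynomial.X ^ (n + 1) * q) := by
      linear_combination (-(Polynomial.X ^ (n + 1))) * hab
    have := congrArg (Polynomial.aeval x) this
    rwa [map_add, map_mul, h0, mul_zero, map_mul _ b, hx, mul_zero, add_zero, map_pow,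
      Polynomial.aeval_X] at this
  · right
    have e1 : x * Polynomial.aeval x (a * Polynomial.X ^ n) = 1 := by
      rw [← h1, show a * Polynomial.X ^ (n + 1) = Polynomial.X * (a * Polynomial.X ^ n) by ring,
        map_mul _ Polynomial.X, Polynomial.aeval_X]
    have e2 : Polynomial.aeval x (a * Polynomial.X ^ n) * x = 1 := by
      rw [← h1, pow_succ, ← mul_assoc, map_mul _ _ Polynomial.X, Polynomial.aeval_X]
    exact ⟨⟨x, _, e1, e2⟩, rfl⟩

/-- If `y * x` were a unit, all powers of the nilpotent `x` would be left regular. So `y * x` is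
nilpotent and `1 + y * x` is a unit. -/
theorem mem_jacobson_of_not_isUnit [Nontrivial A] (h : ∀ x : A, IsNilpotent x ∨ IsUnit x)
    {x : A} (hx : ¬ IsUnit x) : x ∈ Ring.jacobson A := by
  have hxn : IsNilpotent x := (h x).resolve_right hx
  rw [← Ideal.jacobson_bot, Ideal.mem_jacobson_iff]
  intro y
  have hyx : IsNilpotent (y * x) := by
    refine (h (y * x)).resolve_right fun ⟨v, hv⟩ => ?_
    obtain ⟨n, hn⟩ := hxn
    have hreg : IsLeftRegular (x ^ n) :=
      (isLeftRegular_of_mul_eq_one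
        (show (↑v⁻¹ * y) * x = 1 by rw [mul_assoc, ← hv, v.inv_mul])).pow n
    exact one_ne_zero (hreg (by simp [hn] : x ^ n * 1 = x ^ n * 0))
  obtain ⟨v, hv⟩ := hyx.isUnit_one_add
  refine ⟨↑v⁻¹, ?_⟩
  have : (↑v⁻¹ : A) * y * x + ↑v⁻¹ - 1 = ↑v⁻¹ * (1 + y * x) - 1 := by noncomm_ring
  rw [this, ← hv, v.inv_mul, sub_self]
  exact zero_mem _

theorem nonempty_quotient_jacobson_algEquiv [IsAlgClosed k] [Algebra k A] [FiniteDimensional k A]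
    [Nontrivial A] (h : ∀ x : A, IsNilpotent x ∨ IsUnit x) : Nonempty ((A ⧸ Ring.jacobson A) ≃ₐ[k] k) := by
  have hne : Ring.jacobson A ≠ ⊤ := by
    rw [← Ideal.jacobson_bot]
    exact fun e => bot_ne_top (Ideal.jacobson_eq_top_iff.1 e)
  have : Nontrivial (A ⧸ Ring.jacobson A) := Ideal.Quotient.nontrivial_iff.2 hne
  refine ⟨(AlgEquiv.ofBijective (Algebra.ofId k (A ⧸ Ring.jacobson A))
    ⟨(algebraMap k (A ⧸ Ring.jacobson A)).injective, fun y => ?_⟩).symm⟩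
  obtain ⟨x, rfl⟩ := Ideal.Quotient.mk_surjective y
  obtain ⟨c, hc⟩ := spectrum.nonempty_of_isAlgClosed_of_finiteDimensional k x
  refine ⟨c, ?_⟩
  have := mem_jacobson_of_not_isUnit h (spectrum.mem_iff.1 hc)
  exact (Ideal.Quotient.mk_eq_mk_iff_sub_mem _ _).2 this

end LocalAlgebra

section Indecomposable

variable {C : Type u} [Category.{v} C] [Abelian C]

theorem _root_.CategoryTheory.Indecomposable.eq_zero_or_eq_id {P : C} (hP : Indecomposable P)
    (e : P ⟶ P) (he : e ≫ e = e) : e = 0 ∨ e = 𝟙 P := by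
  obtain ⟨Y, i, r, hi, hr⟩ := IsIdempotentComplete.idempotents_split P e he
  obtain ⟨Z, j, s, hj, hs⟩ := IsIdempotentComplete.idempotents_split P (𝟙 P - e)
    (Idempotents.idem_of_id_sub_idem e he)
  have his : i ≫ s = 0 := by
    have : (i ≫ s) ≫ j = 0 := by
      rw [Category.assoc, hs, Preadditive.comp_sub, Category.comp_id, ← hr, reassoc_of% hi, sub_self]
    rw [← Category.comp_id (i ≫ s), ← hj, ← Category.assoc, this, zero_comp]
  have hjr : j ≫ r = 0 := by
    have h1 : j = j ≫ (𝟙 P - e) := by rw [← hs, reassoc_of% hj]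
    have : (j ≫ r) ≫ i = 0 := by
      rw [Category.assoc, hr, h1, Category.assoc, Preadditive.sub_comp, Category.id_comp, he,
        sub_self, comp_zero]
    rw [← Category.comp_id (j ≫ r), ← hi, ← Category.assoc, this, zero_comp]
  let iso : P ≅ Y ⊞ Z :=
    { hom := biprod.lift r s
      inv := biprod.desc i j
      hom_inv_id := by rw [biprod.lift_desc, hr, hs, add_sub_cancel]
      inv_hom_id := by
        apply biprod.hom_ext <;> apply biprod.hom_ext' <;> simp [hi, hj, his, hjr] }
  rcases hP.2 Y Z iso with h | h
  · left
    rw [← hr, h.eq_zero_of_src i, comp_zero]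
  · right
    rw [h.eq_zero_of_src j, comp_zero] at hs
    exact (sub_eq_zero.1 hs.symm).symm

end Indecomposable

/-! ### Existence and uniqueness of simple quotients and subobjects -/

section SimpleQuotient

variable {C : Type u} [Category.{v} C] [Abelian C]

/-- If the nonzero quotients of `P` are detected by morphisms to a fixed object, then `P` has a
simple quotient. -/
theorem exists_simple_quotient (k : Type w) [Field k] [Linear k C]
    (hfin : ∀ X Y : C, Module.Finite k (X ⟶ Y)) {P : C} (hP : ¬ IsZero P) (I : C)
    (h : ∀ (W : C) (q : P ⟶ W), Epi q → ¬ IsZero W → ∃ f : W ⟶ I, f ≠ 0) :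
    ∃ (β : C) (ε : P ⟶ β), Simple β ∧ Epi ε := by
  classical
  have hex : ∃ n : ℕ, ∃ (W : C) (q : P ⟶ W), Epi q ∧ ¬ IsZero W ∧
      Module.finrank k (W ⟶ I) = n := ⟨_, P, 𝟙 P, inferInstance, hP, rfl⟩
  obtain ⟨W, q, hq, hW, hn⟩ := Nat.find_spec hex
  obtain ⟨f, hf⟩ := h W q hq hW
  have hI : ¬ IsZero (image f) := fun hz => hf (by
    rw [← image.fac f, hz.eq_zero_of_src (image.ι f), comp_zero])
  refine ⟨image f, q ≫ factorThruImage f, simple_of_cosimple _ fun {Z} g hg => ⟨?_, fun hg0 => ?_⟩,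
    inferInstance⟩
  · rintro hiso rfl
    exact hI ((IsZero.iff_id_eq_zero _).2 (by
      rw [← IsIso.hom_inv_id (0 : image f ⟶ Z), zero_comp]))
  · have hZ : ¬ IsZero Z := fun hz => hg0 (hz.eq_zero_of_tgt g)
    -- By minimality, precomposition `Hom(Z, I) → Hom(W, I)` is bijective; hence `f` factors through
    -- `Z`, forcing `g` to be mono.
    have hle : Module.finrank k (W ⟶ I) ≤ Module.finrank k (Z ⟶ I) := by
      rw [hn]
      exact Nat.find_min' hex ⟨Z, q ≫ factorThruImage f ≫ g, inferInstance, hZ, rfl⟩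
    have hinj : Function.Injective (Linear.leftComp k I (factorThruImage f ≫ g)) :=
      fun a b hab => (cancel_epi (factorThruImage f ≫ g)).1 hab
    have hsurj := (LinearMap.injective_iff_surjective_of_finrank_eq_finrank
      (le_antisymm (LinearMap.finrank_le_finrank_of_injective hinj) hle)).1 hinj
    obtain ⟨x, hx⟩ := hsurj f
    have hx' : g ≫ x = image.ι f := by
      rw [← cancel_epi (factorThruImage f), image.fac, ← Category.assoc]
      exact hx
    have : Mono (g ≫ x) := hx' ▸ inferInstance
    have : Mono g := mono_of_mono g x
    exact isIso_of_mono_of_epi g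

/-- If the nonzero subobjects of `P` are detected by morphisms from a fixed object, then `P` has a
simple subobject. -/
theorem exists_simple_subobject (k : Type w) [Field k] [Linear k C]
    (hfin : ∀ X Y : C, Module.Finite k (X ⟶ Y)) {P : C} (hP : ¬ IsZero P) (Q : C)
    (h : ∀ (U : C) (i : U ⟶ P), Mono i → ¬ IsZero U → ∃ f : Q ⟶ U, f ≠ 0) :
    ∃ (α : C) (η : α ⟶ P), Simple α ∧ Mono η := by
  classical
  have hex : ∃ n : ℕ, ∃ (U : C) (i : U ⟶ P), Mono i ∧ ¬ IsZero U ∧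
      Module.finrank k (Q ⟶ U) = n := ⟨_, P, 𝟙 P, inferInstance, hP, rfl⟩
  obtain ⟨U, i, hi, hU, hn⟩ := Nat.find_spec hex
  obtain ⟨f, hf⟩ := h U i hi hU
  have hI : ¬ IsZero (image f) := fun hz => hf (by
    rw [← image.fac f, hz.eq_zero_of_src (image.ι f), comp_zero])
  refine ⟨image f, image.ι f ≫ i, ⟨fun {Z} g hg => ⟨?_, fun hg0 => ?_⟩⟩, inferInstance⟩
  · rintro hiso rfl
    exact hI ((IsZero.iff_id_eq_zero _).2 (by
      rw [← IsIso.inv_hom_id (0 : Z ⟶ image f), comp_zero]))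
  · have hZ : ¬ IsZero Z := fun hz => hg0 (hz.eq_zero_of_src g)
    have hle : Module.finrank k (Q ⟶ U) ≤ Module.finrank k (Q ⟶ Z) := by
      rw [hn]
      exact Nat.find_min' hex ⟨Z, g ≫ image.ι f ≫ i, inferInstance, hZ, rfl⟩
    have hinj : Function.Injective (Linear.rightComp k Q (g ≫ image.ι f)) :=
      fun a b hab => (cancel_mono (g ≫ image.ι f)).1 hab
    have hsurj := (LinearMap.injective_iff_surjective_of_finrank_eq_finrank
      (le_antisymm (LinearMap.finrank_le_finrank_of_injective hinj) hle)).1 hinj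
    obtain ⟨x, hx⟩ := hsurj f
    have hx' : x ≫ g = factorThruImage f := by
      rw [← cancel_mono (image.ι f), image.fac, Category.assoc]
      exact hx
    have : Epi (x ≫ g) := hx' ▸ inferInstance
    have : Epi g := epi_of_epi x g
    exact isIso_of_mono_of_epi g

/-- A projective object with local endomorphism ring has at most one simple quotient. -/
theorem isUniqueSimpleQuotient_of_projective {P β : C} [Projective P]
    (hloc : ∀ g : P ⟶ P, IsIso g ∨ IsIso (𝟙 P - g)) (ε : P ⟶ β) [Simple β] [Epi ε] :
    IsUniqueSimpleQuotient ε := by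
  refine ⟨inferInstance, inferInstance, fun S q hS hq => ?_⟩
  have ne_zero : ∀ {T : C} (p : P ⟶ T) [Epi p] [Simple T], p ≠ 0 := by
    rintro T p hp hT rfl
    exact Simple.not_isZero T (IsZero.of_epi_zero P T)
  have hker : kernel.ι ε ≫ q = 0 := by
    by_contra hne
    have : Epi (kernel.ι ε ≫ q) := epi_of_nonzero_to_simple hne
    have hg : Projective.factorThru q (kernel.ι ε ≫ q) ≫ kernel.ι ε ≫ q = q :=
      Projective.factorThru_comp _ _
    generalize Projective.factorThru q (kernel.ι ε ≫ q) = g at hg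
    -- The endomorphism `g ≫ kernel.ι ε` is killed by `ε`, and its complement by `q`; whichever is
    -- invertible kills `ε` or `q`.
    rcases hloc (g ≫ kernel.ι ε) with h | h
    · apply ne_zero ε
      rw [← cancel_epi (g ≫ kernel.ι ε), Category.assoc, kernel.condition, comp_zero, comp_zero]
    · apply ne_zero q
      rw [← cancel_epi (𝟙 P - g ≫ kernel.ι ε), Preadditive.sub_comp, Category.assoc, hg,
        Category.id_comp, sub_self, comp_zero]
  have hfac : ε ≫ Abelian.epiDesc ε q hker = q := Abelian.comp_epiDesc _ _ _
  have : IsIso (Abelian.epiDesc ε q hker) :=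
    isIso_of_hom_simple fun h0 => ne_zero q (by rw [← hfac, h0, comp_zero])
  exact ⟨asIso (Abelian.epiDesc ε q hker), hfac⟩

/-- An injective object with local endomorphism ring has at most one simple subobject. -/
theorem isUniqueSimpleSubobject_of_injective {P α : C} [Injective P]
    (hloc : ∀ g : P ⟶ P, IsIso g ∨ IsIso (𝟙 P - g)) (η : α ⟶ P) [Simple α] [Mono η] :
    IsUniqueSimpleSubobject η := by
  refine ⟨inferInstance, inferInstance, fun S i hS hi => ?_⟩
  have ne_zero : ∀ {T : C} (p : T ⟶ P) [Mono p] [Simple T], p ≠ 0 := by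
    rintro T p hp hT rfl
    exact Simple.not_isZero T (IsZero.of_mono_zero T P)
  have hcok : i ≫ cokernel.π η = 0 := by
    by_contra hne
    have : Mono (i ≫ cokernel.π η) := mono_of_nonzero_from_simple hne
    have hg : (i ≫ cokernel.π η) ≫ Injective.factorThru i (i ≫ cokernel.π η) = i :=
      Injective.comp_factorThru _ _
    generalize Injective.factorThru i (i ≫ cokernel.π η) = g at hg
    rw [Category.assoc] at hg
    rcases hloc (cokernel.π η ≫ g) with h | h
    · apply ne_zero η
      rw [← cancel_mono (cokernel.π η ≫ g), cokernel.condition_assoc, zero_comp, zero_comp]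
    · apply ne_zero i
      rw [← cancel_mono (𝟙 P - cokernel.π η ≫ g), Preadditive.comp_sub, hg,
        Category.comp_id, sub_self, zero_comp]
  have hfac : Abelian.monoLift η i hcok ≫ η = i := Abelian.monoLift_comp _ _ _
  have : IsIso (Abelian.monoLift η i hcok) :=
    isIso_of_hom_simple fun h0 => ne_zero i (by rw [← hfac, h0, zero_comp])
  exact ⟨asIso (Abelian.monoLift η i hcok), hfac⟩

end SimpleQuotient

/-! ### Consequences of rigidity and simplicity of the unit -/

section Duality

variable {C : Type u} [Category.{v} C] [MonoidalCategory C] [TwoSidedDuality C]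

instance (V : C) : ExactPairing V (dual V) := TwoSidedDuality.leftPairing V

instance (V : C) : ExactPairing (dual V) V := TwoSidedDuality.rightPairing V

instance (V : C) : (tensorLeft V).IsLeftAdjoint :=
  (tensorLeftAdjunction (dual V) V).isLeftAdjoint

instance (V : C) : (tensorLeft V).IsRightAdjoint :=
  (tensorLeftAdjunction V (dual V)).isRightAdjoint

instance (V : C) : (tensorRight V).IsLeftAdjoint :=
  (tensorRightAdjunction V (dual V)).isLeftAdjoint

instance (V : C) : (tensorRight V).IsRightAdjoint :=
  (tensorRightAdjunction (dual V) V).isRightAdjoint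

instance (V : C) {X Y : C} (f : X ⟶ Y) [Mono f] : Mono (V ◁ f) :=
  inferInstanceAs (Mono ((tensorLeft V).map f))

instance (V : C) {X Y : C} (f : X ⟶ Y) [Epi f] : Epi (V ◁ f) :=
  inferInstanceAs (Epi ((tensorLeft V).map f))

instance (V : C) {X Y : C} (f : X ⟶ Y) [Mono f] : Mono (f ▷ V) :=
  inferInstanceAs (Mono ((tensorRight V).map f))

instance (V : C) {X Y : C} (f : X ⟶ Y) [Epi f] : Epi (f ▷ V) :=
  inferInstanceAs (Epi ((tensorRight V).map f))

theorem projective_tensor_left (V P : C) [hP : Projective P] : Projective (V ⊗ P) :=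
  (tensorLeftAdjunction (dual V) V).map_projective P hP

theorem projective_tensor_right (V P : C) [hP : Projective P] : Projective (P ⊗ V) :=
  (tensorRightAdjunction V (dual V)).map_projective P hP

theorem injective_tensor_left (V I : C) [hI : Injective I] : Injective (V ⊗ I) :=
  (tensorLeftAdjunction V (dual V)).map_injective I hI

theorem injective_tensor_right (V I : C) [hI : Injective I] : Injective (I ⊗ V) :=
  (tensorRightAdjunction (dual V) V).map_injective I hI

/-- The zigzag identity exhibits `V*` as a retract of `V* ⊗ V ⊗ V*`. -/
def dualRetract (V : C) : Retract (dual V) (dual V ⊗ V ⊗ dual V) where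
  i := (ρ_ _).inv ≫ dual V ◁ η_ V (dual V)
  r := (α_ _ _ _).inv ≫ ε_ V (dual V) ▷ dual V ≫ (λ_ _).hom
  retract := by simp

/-- The zigzag identity exhibits `V` as a retract of `V ⊗ V* ⊗ V`. -/
def selfRetract (V : C) : Retract V (V ⊗ dual V ⊗ V) where
  i := (ρ_ _).inv ≫ V ◁ η_ (dual V) V
  r := (α_ _ _ _).inv ≫ ε_ (dual V) V ▷ V ≫ (λ_ _).hom
  retract := by simp

theorem projective_dual (P : C) [Projective P] : Projective (dual P) :=
  (dualRetract P).projective (p := projective_tensor_left _ _ (hP := projective_tensor_right _ P))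

/-- If `X` is invertible and `X ⊗ V` is projective, then `V` is projective. -/
theorem IsInvertible.projective_of_tensor {X V : C} (hX : IsInvertible X)
    (h : Projective (X ⊗ V)) : Projective V := by
  have := hX.1
  exact Projective.of_iso
    ((α_ (dual X) X V).symm ≪≫ whiskerRightIso (asIso (evL X)) V ≪≫ λ_ V)
    (projective_tensor_left (dual X) (X ⊗ V))

end Duality

section AbelianDuality

variable {C : Type u} [Category.{v} C] [Abelian C] [MonoidalCategory C] [MonoidalPreadditive C]
  [TwoSidedDuality C]

/-- Whiskering a monomorphism by a projective object gives a split monomorphism. -/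
theorem exists_retraction_whiskerLeft (P : C) [Projective P] {X Y : C} (f : X ⟶ Y) [Mono f] :
    ∃ r : P ⊗ Y ⟶ P ⊗ X, P ◁ f ≫ r = 𝟙 _ := by
  let S : ShortComplex C := ShortComplex.mk f (cokernel.π f) (cokernel.condition f)
  have hS : S.ShortExact :=
    { exact := ShortComplex.exact_cokernel f
      mono_f := inferInstanceAs (Mono f)
      epi_g := inferInstanceAs (Epi (cokernel.π f)) }
  have hS' : (S.map (tensorLeft P)).ShortExact := hS.map_of_exact (tensorLeft P)
  have : Projective (S.map (tensorLeft P)).X₃ :=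
    projective_tensor_right (cokernel f) P
  exact ⟨hS'.splittingOfProjective.r, hS'.splittingOfProjective.f_r⟩

/-- Projective objects are injective. -/
theorem injective_of_projective (P : C) [Projective P] : Injective P := by
  refine Injective.of_iso (ρ_ P) ⟨fun {X Y} g f hf => ?_⟩
  have := projective_dual P
  -- Maps `X ⟶ P ⊗ 𝟙` correspond to maps `P* ⊗ X ⟶ 𝟙`, which extend along the split mono `P* ◁ f`.
  obtain ⟨r, hr⟩ := exists_retraction_whiskerLeft (dual P) f
  refine ⟨tensorLeftHomEquiv Y P (dual P) (𝟙_ C)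
    (r ≫ (tensorLeftHomEquiv X P (dual P) (𝟙_ C)).symm g), ?_⟩
  apply (tensorLeftHomEquiv X P (dual P) (𝟙_ C)).symm.injective
  rw [tensorLeftHomEquiv_symm_naturality, Equiv.symm_apply_apply, reassoc_of% hr]

/-- The transpose `𝟙 ⟶ 𝟙 ⊗ U*` of a morphism `U ⟶ 𝟙`. -/
def unitTranspose {U : C} (i : U ⟶ 𝟙_ C) : 𝟙_ C ⟶ 𝟙_ C ⊗ dual U :=
  η_ U (dual U) ≫ i ▷ dual U

instance epi_unitTranspose {U : C} (i : U ⟶ 𝟙_ C) [Mono i] : Epi (unitTranspose i) := by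
  refine Preadditive.epi_of_cancel_zero _ fun {Z} g hg => ?_
  have h1 : (η_ U (dual U) ≫ U ◁ ((λ_ _).inv ≫ g)) ≫ i ▷ Z = 0 := by
    rw [Category.assoc, whisker_exchange]
    have : η_ U (dual U) ≫ i ▷ dual U ≫ g = 0 := by simpa [unitTranspose] using hg
    have h2 : i ▷ dual U ≫ 𝟙_ C ◁ ((λ_ _).inv ≫ g) = (i ▷ dual U ≫ g) ≫ (λ_ _).inv := by simp
    rw [h2, ← Category.assoc, this, zero_comp]
  have h2 := zero_of_comp_mono _ h1
  have h3 : (ρ_ _).hom ≫ (λ_ _).inv ≫ g = 0 := by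
    apply (tensorLeftHomEquiv (𝟙_ C) U (dual U) Z).injective
    trans (0 : 𝟙_ C ⟶ U ⊗ Z)
    · rw [← h2]; simp [tensorLeftHomEquiv, ← unitors_equal]
    · simp [tensorLeftHomEquiv]
  simpa using h3

theorem comp_unitTranspose_eq_zero {U X : C} (i : U ⟶ 𝟙_ C) [Mono i] (h : X ⟶ 𝟙_ C)
    (hh : h ≫ unitTranspose i = 0) : h ▷ U = 0 := by
  have e : unitTranspose i = tensorRightHomEquiv (𝟙_ C) U (dual U) (𝟙_ C) ((λ_ U).hom ≫ i) := by
    simp [unitTranspose, tensorRightHomEquiv, unitors_equal]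
  have h1 : h ▷ U ≫ (λ_ U).hom ≫ i = 0 := by
    have := tensorRightHomEquiv_symm_naturality (Y := U) (Y' := dual U) (Z := 𝟙_ C) h
      (unitTranspose i)
    rw [hh] at this
    conv_rhs at this => rw [e, Equiv.symm_apply_apply]
    rw [← this]
    simp [tensorRightHomEquiv]
  exact zero_of_comp_mono _ h1

/-- `K ⊗ K` embeds by the zero map, so it vanishes. The epi `𝟙 ⟶ K*` makes `K ⊗ K* ⊗ K` a quotient
of it, and `K` is a retract of that. -/
theorem isZero_of_whiskerRight_eq_zero {K : C} (κ : K ⟶ 𝟙_ C) [Mono κ] (h : κ ▷ K = 0) :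
    IsZero K := by
  have hKK : IsZero (K ⊗ K) := IsZero.of_mono_eq_zero _ h
  have hK : IsZero (K ⊗ 𝟙_ C ⊗ K) := hKK.of_iso (whiskerLeftIso K (λ_ K))
  have hz : IsZero (K ⊗ dual K ⊗ K) :=
    IsZero.of_epi (K ◁ (unitTranspose κ ≫ (λ_ _).hom) ▷ K) hK
  exact IsZero.of_mono (selfRetract K).i hz

/-- A subobject of the unit is mapped isomorphically onto its dual. -/
theorem isIso_comp_unitTranspose {U : C} (i : U ⟶ 𝟙_ C) [Mono i] :
    IsIso (i ≫ unitTranspose i) := by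
  have hepi : Epi (i ≫ unitTranspose i) := by
    have h0 : Epi (η_ U (dual U) ≫ i ▷ dual U) := epi_unitTranspose i
    have h1 : Epi (i ▷ dual U) := epi_of_epi (η_ U (dual U)) (i ▷ dual U)
    have h2 : i ≫ unitTranspose i =
        (ρ_ U).inv ≫ U ◁ (unitTranspose i ≫ (λ_ _).hom) ≫ i ▷ dual U := by
      rw [whisker_exchange]
      simp [← unitors_inv_equal]
    rw [h2]
    infer_instance
  have hmono : Mono (i ≫ unitTranspose i) := by
    refine Preadditive.mono_of_isZero_kernel _ ?_
    set κ := kernel.ι (i ≫ unitTranspose i)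
    have h1 : (κ ≫ i) ▷ U = 0 := comp_unitTranspose_eq_zero i _ (by
      rw [Category.assoc]; exact kernel.condition _)
    have h2 : (κ ≫ i) ▷ kernel (i ≫ unitTranspose i) ≫ 𝟙_ C ◁ κ = 0 := by
      rw [← whisker_exchange, h1, comp_zero]
    exact isZero_of_whiskerRight_eq_zero (κ ≫ i) (zero_of_comp_mono _ h2)
  exact isIso_of_mono_of_epi _

/-- The unit is simple if its endomorphisms are scalars. -/
theorem simple_unit (k : Type w) [Field k] [Linear k C]
    (hunit : AbsolutelyIrreducible k (𝟙_ C)) : Simple (𝟙_ C) := by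
  refine ⟨fun {U} i hi => ⟨?_, fun hi0 => ?_⟩⟩
  · rintro hiso rfl
    have h0 : 𝟙 (𝟙_ C) = 0 := by rw [← IsIso.inv_hom_id (0 : U ⟶ 𝟙_ C), comp_zero]
    have : (1 : k) = 0 := hunit.1 (by simp [h0])
    exact one_ne_zero this
  · have := isIso_comp_unitTranspose i
    -- This idempotent of the unit has image `U`; it is a scalar fixing `i ≠ 0`, hence the identity,
    -- so `i` is split epi.
    obtain ⟨c, hc⟩ := hunit.2 (unitTranspose i ≫ inv (i ≫ unitTranspose i) ≫ i)
    have h1 : i ≫ unitTranspose i ≫ inv (i ≫ unitTranspose i) ≫ i = i := by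
      rw [← Category.assoc, IsIso.hom_inv_id_assoc]
    rw [← hc] at h1
    have h2 : (c - 1) • i = 0 := by simpa [sub_smul, sub_eq_zero] using h1
    have h3 : c = 1 := sub_eq_zero.1 ((smul_eq_zero.1 h2).resolve_right hi0)
    have : IsSplitEpi i := ⟨⟨⟨unitTranspose i ≫ inv (i ≫ unitTranspose i), by
      simpa [h3] using hc.symm⟩⟩⟩
    exact isIso_of_mono_of_epi i

end AbelianDuality

section HomEquiv

variable {C : Type u} [Category.{v} C] [Preadditive C] [MonoidalCategory C] [MonoidalPreadditive C]

theorem tensorRightHomEquiv_ne_zero {X Y Y' Z : C} [ExactPairing Y Y'] {f : X ⊗ Y ⟶ Z}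
    (hf : f ≠ 0) : tensorRightHomEquiv X Y Y' Z f ≠ 0 := by
  intro h
  apply hf
  rw [← (tensorRightHomEquiv X Y Y' Z).symm_apply_apply f, h]
  simp [tensorRightHomEquiv]

theorem tensorLeftHomEquiv_symm_ne_zero {X Y Y' Z : C} [ExactPairing Y Y'] {f : X ⟶ Y ⊗ Z}
    (hf : f ≠ 0) : (tensorLeftHomEquiv X Y Y' Z).symm f ≠ 0 := by
  intro h
  apply hf
  rw [← (tensorLeftHomEquiv X Y Y' Z).apply_symm_apply f, h]
  simp [tensorLeftHomEquiv]

end HomEquiv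

/-! ### Test objects for quotients and subobjects; the trace ideal -/

section Projective

variable {C : Type u} [Category.{v} C] [Abelian C] [MonoidalCategory C] [MonoidalPreadditive C]
  [TwoSidedDuality C]

theorem coevaluation_ne_zero {P : C} (hP : ¬ IsZero P) : η_ P (dual P) ≠ 0 := by
  intro h
  apply hP
  have := ExactPairing.evaluation_coevaluation P (dual P)
  rw [h] at this
  simp only [MonoidalPreadditive.zero_whiskerRight, zero_comp] at this
  rw [IsZero.iff_id_eq_zero, ← cancel_epi (λ_ P).hom, ← cancel_mono (ρ_ P).inv]
  simpa using this.symm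

theorem evaluation_ne_zero {P : C} (hP : ¬ IsZero P) : ε_ (dual P) P ≠ 0 := by
  intro h
  apply hP
  have := ExactPairing.coevaluation_evaluation (dual P) P
  rw [h] at this
  simp only [MonoidalPreadditive.zero_whiskerRight, comp_zero] at this
  rw [IsZero.iff_id_eq_zero, ← cancel_epi (ρ_ P).hom, ← cancel_mono (λ_ P).inv]
  simpa using this.symm

/-- The nonzero quotients of an injective object `P` map nontrivially to `(P ⊗ P*) ⊗ P`. -/
theorem exists_hom_ne_zero_of_quotient [Simple (𝟙_ C)] {P W : C} [Injective P] (hP : ¬ IsZero P)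
    (q : P ⟶ W) [Epi q] (hW : ¬ IsZero W) : ∃ f : W ⟶ (P ⊗ dual P) ⊗ P, f ≠ 0 := by
  have hq : (λ_ P).hom ≫ q ≠ 0 := fun h => hW (IsZero.of_epi_eq_zero _ h)
  have hmono : Mono (tensorRightHomEquiv (𝟙_ C) P (dual P) W ((λ_ P).hom ≫ q)) :=
    mono_of_nonzero_from_simple (tensorRightHomEquiv_ne_zero hq)
  have : Injective (P ⊗ dual P) := injective_tensor_right _ P
  -- Simplicity of the unit made the adjunct `𝟙 ⟶ W ⊗ P*` mono, so the nonzero coevaluation extends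
  -- along it to `W ⊗ P* ⟶ P ⊗ P*`.
  obtain ⟨r, hr⟩ := Injective.factors (η_ P (dual P))
    (tensorRightHomEquiv (𝟙_ C) P (dual P) W ((λ_ P).hom ≫ q))
  have hr0 : r ≠ 0 := by
    rintro rfl
    exact coevaluation_ne_zero hP (by rw [← hr, comp_zero])
  exact ⟨_, tensorRightHomEquiv_ne_zero (Y := dual P) (Y' := P) hr0⟩

/-- The nonzero subobjects of a projective object `P` receive nonzero morphisms from
`P ⊗ P ⊗ P*`. -/
theorem exists_hom_ne_zero_of_subobject [Simple (𝟙_ C)] {P U : C} [Projective P]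
    (hP : ¬ IsZero P) (i : U ⟶ P) [Mono i] (hU : ¬ IsZero U) :
    ∃ f : P ⊗ P ⊗ dual P ⟶ U, f ≠ 0 := by
  have hi : i ≫ (ρ_ P).inv ≠ 0 := fun h => hU (IsZero.of_mono_eq_zero _ h)
  have hepi : Epi ((tensorLeftHomEquiv U P (dual P) (𝟙_ C)).symm (i ≫ (ρ_ P).inv)) :=
    epi_of_nonzero_to_simple (tensorLeftHomEquiv_symm_ne_zero hi)
  have : Projective (P ⊗ dual P) := projective_tensor_right _ P
  obtain ⟨r, hr⟩ := Projective.factors (ε_ (dual P) P)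
    ((tensorLeftHomEquiv U P (dual P) (𝟙_ C)).symm (i ≫ (ρ_ P).inv))
  have hr0 : r ≠ 0 := by
    rintro rfl
    exact evaluation_ne_zero hP (by rw [← hr, zero_comp])
  exact ⟨_, tensorLeftHomEquiv_symm_ne_zero (Y := dual P) (Y' := P) hr0⟩

theorem projective_le_traceIdeal {P α β : C} (η : α ⟶ P) [Mono η] (ε : P ⟶ β) [Epi ε] :
    isProjective C ≤ traceIdeal η ε := by
  intro V (hV : Projective V)
  have := injective_of_projective V
  have : Injective (α ⊗ V) := injective_tensor_left α V
  have : Projective (β ⊗ V) := projective_tensor_left β V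
  exact ⟨⟨_, Injective.comp_factorThru (𝟙 (α ⊗ V)) (η ▷ V)⟩,
    ⟨_, Projective.factorThru_comp (𝟙 (β ⊗ V)) (ε ▷ V)⟩⟩

theorem projective_eq_traceIdeal {P α β : C} [Projective P] (η : α ⟶ P) [Mono η] (ε : P ⟶ β)
    [Epi ε] (h : IsInvertible α ∨ IsInvertible β) : isProjective C = traceIdeal η ε := by
  refine le_antisymm (projective_le_traceIdeal η ε) ?_
  rintro V ⟨⟨s, hs⟩, ⟨t, ht⟩⟩
  have hPV : Projective (P ⊗ V) := projective_tensor_right V P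
  change Projective V
  rcases h with h | h
  · exact h.projective_of_tensor (Retract.mk (η ▷ V) s hs).projective
  · exact h.projective_of_tensor (Retract.mk t (ε ▷ V) ht).projective

end Projective

section Schur

variable (k : Type w) [Field k] {C : Type u} [Category.{v} C] [Abelian C] [Linear k C]

theorem smul_injective_of_ne_zero {X Y : C} {f : X ⟶ Y} (hf : f ≠ 0) :
    Function.Injective fun c : k => c • f := smul_left_injective k hf

theorem absolutelyIrreducible_of_simple [IsAlgClosed k]
    (hfin : ∀ X Y : C, Module.Finite k (X ⟶ Y)) (X : C) [Simple X] :
    AbsolutelyIrreducible k X :=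
  ⟨smul_injective_of_ne_zero k (id_nonzero X), endomorphism_simple_eq_smul_id k⟩

theorem IsUniqueSimpleSubobject.bijective_smul {P α : C} {η : α ⟶ P}
    (hη : IsUniqueSimpleSubobject η) (hη0 : η ≠ 0) (hα : AbsolutelyIrreducible k α) :
    Function.Bijective fun c : k => c • η := by
  refine ⟨smul_injective_of_ne_zero k hη0, fun f => ?_⟩
  rcases eq_or_ne f 0 with rfl | hf
  · exact ⟨0, zero_smul k η⟩
  have := hη.simple
  obtain ⟨e, he⟩ := hη.unique α f hη.simple (mono_of_nonzero_from_simple hf)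
  obtain ⟨c, hc⟩ := hα.2 e.hom
  exact ⟨c, by simp [← he, ← hc]⟩

theorem IsUniqueSimpleQuotient.bijective_smul {P β : C} {ε : P ⟶ β}
    (hε : IsUniqueSimpleQuotient ε) (hε0 : ε ≠ 0) (hβ : AbsolutelyIrreducible k β) :
    Function.Bijective fun c : k => c • ε := by
  refine ⟨smul_injective_of_ne_zero k hε0, fun f => ?_⟩
  rcases eq_or_ne f 0 with rfl | hf
  · exact ⟨0, zero_smul k ε⟩
  have := hε.simple
  obtain ⟨e, he⟩ := hε.unique β f hε.simple (epi_of_nonzero_to_simple hf)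
  obtain ⟨c, hc⟩ := hβ.2 e.hom
  exact ⟨c, by simp [← he, ← hc]⟩

end Schur

end MTrace

theorem theoremT {k : Type w} [Field k] [IsAlgClosed k]
    {C : Type u} [Category.{v} C] [Abelian C] [Linear k C]
    [MonoidalCategory C] [MonoidalPreadditive C] [MonoidalLinear k C] [MTrace.Pivotal C]
    (hunit : MTrace.AbsolutelyIrreducible k (𝟙_ C))
    (hfin : MTrace.LocallyFinite k C)
    (P : C) (hind : Indecomposable P) (hproj : Projective P) :
    ∃ (α β : C) (η : α ⟶ P) (ε : P ⟶ β),
      MTrace.AbsolutelyIrreducible k α ∧ MTrace.AbsolutelyIrreducible k β ∧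
      MTrace.IsUniqueSimpleSubobject η ∧ MTrace.IsUniqueSimpleQuotient ε ∧
      MTrace.IsTraceTuple k P α β η ε ∧
      (∀ (α' β' : C) (η' : α' ⟶ P) (ε' : P ⟶ β'),
        Simple α' → Simple β' →
        MTrace.IsTraceTuple k P α' β' η' ε' →
        ∃ (a : α ≅ α') (b : β ≅ β'), a.hom ≫ η' = η ∧ ε ≫ b.hom = ε') ∧
      isProjective C ≤ MTrace.traceIdeal η ε ∧
      (MTrace.IsInvertible α ∨ MTrace.IsInvertible β →
        isProjective C = MTrace.traceIdeal η ε) := by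
  have hfin' : ∀ X Y : C, Module.Finite k (X ⟶ Y) := fun X Y => by
    have := (isFiniteLength_iff_isNoetherian_isArtinian.1 (hfin X Y)).1
    infer_instance
  have : Simple (𝟙_ C) := MTrace.simple_unit k hunit
  have hinj := MTrace.injective_of_projective P
  have hfinEnd : FiniteDimensional k (End P) := hfin' P P
  have hnu : ∀ x : End P, IsNilpotent x ∨ IsUnit x :=
    MTrace.isNilpotent_or_isUnit k hind.eq_zero_or_eq_id
  have hnt : Nontrivial (End P) :=
    nontrivial_of_ne (𝟙 P) 0 fun h => hind.1 ((IsZero.iff_id_eq_zero P).2 h)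
  have hloc : ∀ g : P ⟶ P, IsIso g ∨ IsIso (𝟙 P - g) := fun g => by
    rcases hnu g with h | h
    · exact Or.inr ((isUnit_iff_isIso _).1 h.isUnit_one_sub)
    · exact Or.inl ((isUnit_iff_isIso _).1 h)
  obtain ⟨α, η, hα, hη⟩ := MTrace.exists_simple_subobject k hfin' hind.1 _
    fun U i _ hU => MTrace.exists_hom_ne_zero_of_subobject hind.1 i hU
  obtain ⟨β, ε, hβ, hε⟩ := MTrace.exists_simple_quotient k hfin' hind.1 _
    fun W q _ hW => MTrace.exists_hom_ne_zero_of_quotient hind.1 q hW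
  have hsoc := MTrace.isUniqueSimpleSubobject_of_injective hloc η
  have hhead := MTrace.isUniqueSimpleQuotient_of_projective hloc ε
  have hαk := MTrace.absolutelyIrreducible_of_simple k hfin' α
  have hβk := MTrace.absolutelyIrreducible_of_simple k hfin' β
  have hη0 : η ≠ 0 := fun h => Simple.not_isZero α (IsZero.of_mono_eq_zero η h)
  have hε0 : ε ≠ 0 := fun h => Simple.not_isZero β (IsZero.of_epi_eq_zero ε h)
  have hart : IsArtinianRing (End P) := IsArtinianRing.of_finite k (End P)
  refine ⟨α, β, η, ε, hαk, hβk, hsoc, hhead,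
    ⟨hη0, hε0, MTrace.nonempty_quotient_jacobson_algEquiv k hnu, IsSemiprimaryRing.isNilpotent,
      hsoc.bijective_smul k hη0 hαk, hhead.bijective_smul k hε0 hβk⟩,
    fun α' β' η' ε' hα' hβ' ht => ?_, MTrace.projective_le_traceIdeal η ε,
    MTrace.projective_eq_traceIdeal η ε⟩
  obtain ⟨a, ha⟩ := hsoc.unique α' η' hα' (mono_of_nonzero_from_simple ht.eta_ne_zero)
  obtain ⟨b, hb⟩ := hhead.unique β' ε' hβ' (epi_of_nonzero_to_simple ht.epsilon_ne_zero)
  exact ⟨a.symm, b, by simp [← ha], hb⟩
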